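/- **Definitions.** A VASS $\mathcal V$ of dimension $n$ consists of a finite set $\mathit{Locs}(\mathcal V)$ of locations and a finite set $\mathit{Trns}(\mathcal V)\subseteq \mathit{Locs}(\mathcal V)\times\mathbb Z^n\times \mathit{Locs}(\mathcal V)$ of transitions; it is *connected* if every location is reachable from every location by a (possibly empty) path of transitions. States are pairs $(l,\nu)$ of a location $l$ and a valuation $\nu\in\mathbb N^n$; a step $(l,\nu)\xrightarrow{d}(l',\nu')$ exists iff $\nu'=\nu+d$ and $(l,d,l')\in\mathit{Trns}(\mathcal V)$; a trace is a sequence of consecutive steps, and its length is the number of its steps. A state $(l,\nu)$ is $N$-*bounded* if $\max_i \nu(i)\le N$. The complexity $\mathit{comp}_N(\mathcal V)$ is the length of the longest trace that starts in an $N$-bounded state. A sub-VASS is given by subsets of the locations and of the transitions, and an SCC is a maximal connected sub-VASS. Let $D\in\mathbb Z^{n\times \mathit{Trns}(\mathcal V)}$ be the matrix whose column $t$ is the update of the transition $t$, and let $F\in\mathbb Z^{\mathit{Locs}(\mathcal V)\times\mathit{Trns}(\mathcal V)}$ be the oriented incidence matrix (entry $+1$ at the target and $-1$ at the source of each transition that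 is not a loop; the column of a loop is zero). For a transition $t$ consider the systems * $(A_t)$: $\mu\in\mathbb Z^{\mathit{Trns}(\mathcal V)}$ with $D\mu\ge 0$, $\mu\ge 0$, $F\mu=0$, $\mu(t)\ge 1$; * $(B_t)$: $r\in\mathbb Z^n$, $z\in\mathbb Z^{\mathit{Locs}(\mathcal V)}$ with $r\ge 0$, $z\ge 0$, $D^Tr+F^Tz\le 0$, with strict inequality in line $t$. The procedure $\mathit{ranking}(\mathcal V)$ takes a connected VASS $\mathcal V$. If $\mathit{Trns}(\mathcal V)=\emptyset$, it returns the function that maps every state to the empty sequence. Otherwise let $T$ be the set of transitions $t$ for which $(B_t)$ is solvable. If $T=\emptyset$, it picks a solution $\mu_t$ of each $(A_t)$ and returns $\sum_t\mu_t$ as a witness for non-termination. If $T\ne\emptyset$, it picks a solution $(r_t,z_t)$ of $(B_t)$ for each $t\in T$, sets $\mathit{qrank}(l,\nu)=\sum_{t\in T}(r_t^T\nu+z_t(l))$, and calls itself on every SCC $S$ of $(\mathit{Locs}(\mathcal V),\mathit{Trns}(\mathcal V)\setminus T)$. If some call returns a witness for non-termination, it returns this witness. Otherwise, with $\mathit{rank}_S$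 the function returned for $S$, it returns the function $\mathit{rank}$ with values in the finite sequences over $\mathbb N$ given by $\mathit{rank}(l,\nu)=\langle \mathit{qrank}(l,\nu)\rangle\oplus \mathit{rank}_S(l,\nu)$ for $l\in\mathit{Locs}(S)$, where $\oplus$ is concatenation. A returned function $\mathit{rank}$ is of *order* $k$ if $k$ is the least number such that all its values are sequences of length at most $k$. **Theorem.** Let $\mathcal V$ be a connected VASS (not necessarily conservative) for which $\mathit{ranking}(\mathcal V)$ returns, for some choice of the solutions picked, a lexicographic ranking function of order $k\ge 1$. Then for every $N\in\mathbb N$ there is a longest trace of $\mathcal V$ that starts in an $N$-bounded state, and $\mathit{comp}_N(\mathcal V)\in\Omega(N^k)$ as $N\to\infty$. -/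

import Mathlib

open scoped Matrix

/-- A transition `l₁ --d--> l₂`, as the triple `(l₁, d, l₂)`. -/
abbrev VASSTransition (L : Type*) (n : ℕ) : Type _ := L × (Fin n → ℤ) × L

/-- A vector addition system with states of dimension `n`: a finite set of locations (drawn from
an ambient type `L`, so that sub-systems live in the same type) and a finite set of transitions
between these locations. -/
@[ext]
structure VASS (L : Type*) (n : ℕ) where
  /-- the locations -/
  locs : Finset L
  /-- the transitions -/
  trans : Finset (VASSTransition L n)
  src_mem : ∀ t ∈ trans, t.1 ∈ locs
  tgt_mem : ∀ t ∈ trans, t.2.2 ∈ locs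

namespace VASS

variable {L : Type*} {n : ℕ}

/-- `S ≤ V`: `S` is a sub-VASS of `V`. -/
instance : PartialOrder (VASS L n) where
  le S V := S.locs ⊆ V.locs ∧ S.trans ⊆ V.trans
  le_refl _ := ⟨Finset.Subset.refl _, Finset.Subset.refl _⟩
  le_trans _ _ _ h h' := ⟨h.1.trans h'.1, h.2.trans h'.2⟩
  le_antisymm _ _ h h' :=
    VASS.ext (Finset.Subset.antisymm h.1 h'.1) (Finset.Subset.antisymm h.2 h'.2)

/-- There is a (possibly empty) path from `l` to `l'`. -/
def HasPath (V : VASS L n) : L → L → Prop :=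
  Relation.ReflTransGen fun l l' => ∃ d, (l, d, l') ∈ V.trans

/-- Every location can be reached from every location. -/
def Connected (V : VASS L n) : Prop :=
  ∀ l ∈ V.locs, ∀ l' ∈ V.locs, V.HasPath l l'

/-- The strongly-connected components: the maximal connected sub-VASSs. -/
def sccs (V : VASS L n) : Set (VASS L n) :=
  {S | Maximal (fun S' : VASS L n => S' ≤ V ∧ S'.Connected) S}

/-- States: a location together with a valuation in `ℕ^n`. -/
abbrev State (V : VASS L n) : Type _ := V.locs × (Fin n → ℕ)

/-- A state of a system, seen as a state of another system with at least the same locations. -/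
def liftState {S V : VASS L n} (h : S.locs ⊆ V.locs) (σ : S.State) : V.State :=
  (⟨σ.1.1, h σ.1.2⟩, σ.2)

/-- The step `σ --d--> σ'`. -/
def Step (V : VASS L n) (σ : V.State) (d : Fin n → ℤ) (σ' : V.State) : Prop :=
  (∀ i, (σ'.2 i : ℤ) = (σ.2 i : ℤ) + d i) ∧ (σ.1.1, d, σ'.1.1) ∈ V.trans

/-- `V.Trace σ m τ`: there is a trace of length `m` (that is, with `m` steps) from `σ` to `τ`. -/
inductive Trace (V : VASS L n) : V.State → ℕ → V.State → Prop
  | nil (σ : V.State) : Trace V σ 0 σ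
  | cons {σ σ' τ : V.State} {d : Fin n → ℤ} {m : ℕ} :
      V.Step σ d σ' → Trace V σ' m τ → Trace V σ (m + 1) τ

/-- `σ` is `N`-bounded: the maximum norm of its valuation is at most `N`. -/
def Bounded {V : VASS L n} (N : ℕ) (σ : V.State) : Prop := ∀ i, σ.2 i ≤ N

/-- The lengths of the (finite) traces that start in some `N`-bounded state. -/
def traceLengths (V : VASS L n) (N : ℕ) : Set ℕ :=
  {m | ∃ σ τ : V.State, Bounded N σ ∧ V.Trace σ m τ}

/-- The computational complexity: the length of the longest trace from an `N`-bounded state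
(meaningful whenever a longest such trace exists). -/
noncomputable def comp (V : VASS L n) (N : ℕ) : ℕ := sSup (V.traceLengths N)

/-- The update matrix `D`, whose column `t` is the update of the transition `t`. -/
def updateMatrix (V : VASS L n) : Matrix (Fin n) V.trans ℤ :=
  Matrix.of fun i t => t.1.2.1 i

open Classical in
/-- The oriented incidence matrix `F`: in the column of a transition `t` that is not a loop there
is `1` at the target and `-1` at the source; the column of a loop is `0`. -/
noncomputable def incidenceMatrix (V : VASS L n) : Matrix V.locs V.trans ℤ :=
  Matrix.of fun l t => (if l.1 = t.1.2.2 then 1 else 0) - (if l.1 = t.1.1 then 1 else 0)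

/-- `μ` solves the constraint system `(A_t)`. -/
def SolvesA (V : VASS L n) (t : V.trans) (μ : V.trans → ℤ) : Prop :=
  0 ≤ V.updateMatrix *ᵥ μ ∧ 0 ≤ μ ∧ V.incidenceMatrix *ᵥ μ = 0 ∧ 1 ≤ μ t

/-- `(r, z)` solves the constraint system `(B_t)`. -/
def SolvesB (V : VASS L n) (t : V.trans) (r : Fin n → ℤ) (z : V.locs → ℤ) : Prop :=
  0 ≤ r ∧ 0 ≤ z ∧
    (∀ t', (V.updateMatrixᵀ *ᵥ r + V.incidenceMatrixᵀ *ᵥ z) t' ≤ 0) ∧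
    (V.updateMatrixᵀ *ᵥ r + V.incidenceMatrixᵀ *ᵥ z) t < 0

/-- `affine(r, z)(l, ν) = rᵀ ν + z(l)`, a natural number for `r, z ≥ 0`. -/
def affineRank {V : VASS L n} (r : Fin n → ℤ) (z : V.locs → ℤ) (σ : V.State) : ℕ :=
  (∑ i, r i * (σ.2 i : ℤ) + z σ.1).toNat

open Classical in
/-- The set `T` of the transitions `t` for which `(B_t)` has a solution. -/
noncomputable def decreasing (V : VASS L n) : Finset V.trans :=
  {t | ∃ r z, V.SolvesB t r z}

open Classical in
/-- The VASS `(Locs(V), Trns(V) \ T)`. -/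
noncomputable def removeTrans (V : VASS L n) (T : Finset V.trans) : VASS L n where
  locs := V.locs
  trans := {t ∈ V.trans | ∀ h : t ∈ V.trans, (⟨t, h⟩ : V.trans) ∉ T}
  src_mem t ht := V.src_mem t (Finset.mem_filter.1 ht).1
  tgt_mem t ht := V.tgt_mem t (Finset.mem_filter.1 ht).1

/-- What the procedure `ranking` may return on input `V`: a function from states to finite
sequences of natural numbers, or a vector that witnesses non-termination. -/
inductive Output (V : VASS L n) : Type _
  | termination (rank : V.State → List ℕ) : Output V
  | nontermination (w : VASSTransition L n → ℤ) : Output V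

open Classical in
/-- `Ranking V out`: the procedure `ranking(V)` can return `out`. The procedure is
non-deterministic in which solutions of the constraint systems it picks and in the order in which
it visits the components. -/
inductive Ranking : (V : VASS L n) → Output V → Prop
  /-- There are no transitions: return the function with constant value the empty sequence. -/
  | empty (V : VASS L n) (hV : V.trans = ∅) : Ranking V (.termination fun _ => [])
  /-- No `(B_t)` has a solution: return the sum of the chosen solutions of the `(A_t)`. -/
  | stuck (V : VASS L n) (hV : V.trans ≠ ∅) (hT : V.decreasing = ∅)
      (μ : V.trans → V.trans → ℤ) (hμ : ∀ t, V.SolvesA t (μ t)) :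
      Ranking V (.nontermination fun t =>
        if h : t ∈ V.trans then ∑ t', μ t' ⟨t, h⟩ else 0)
  /-- A recursive call returned a witness for non-termination: return this witness. -/
  | abort (V : VASS L n) (hV : V.trans ≠ ∅) (hT : V.decreasing ≠ ∅)
      (S : VASS L n) (hS : S ∈ (V.removeTrans V.decreasing).sccs)
      (w : VASSTransition L n → ℤ) (hw : Ranking S (.nontermination w)) :
      Ranking V (.nontermination w)
  /-- All recursive calls returned functions `rankS S`: with `qrank` the sum, over `t ∈ T`, of
  the functions `affine(r t, z t)` for the chosen solutions of the `(B_t)`, return the function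
  `rank` with `rank(l, ν) = qrank(l, ν) ⊕ rankS S (l, ν)` for each location `l` of each
  component `S`. (Each location lies in exactly one component, so this determines `rank`.) -/
  | combine (V : VASS L n) (hV : V.trans ≠ ∅) (hT : V.decreasing ≠ ∅)
      (r : V.trans → Fin n → ℤ) (z : V.trans → V.locs → ℤ)
      (hB : ∀ t ∈ V.decreasing, V.SolvesB t (r t) (z t))
      (qrank : V.State → ℕ)
      (hq : ∀ σ, qrank σ = ∑ t ∈ V.decreasing, affineRank (r t) (z t) σ)
      (rankS : ∀ S ∈ (V.removeTrans V.decreasing).sccs, S.State → List ℕ)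
      (hS : ∀ S (hS : S ∈ (V.removeTrans V.decreasing).sccs),
        Ranking S (.termination (rankS S hS)))
      (rank : V.State → List ℕ)
      (hrank : ∀ S (hS : S ∈ (V.removeTrans V.decreasing).sccs) (σ : S.State),
        rank (liftState (V := V) hS.1.1.1 σ) =
          [qrank (liftState (V := V) hS.1.1.1 σ)] ++ rankS S hS σ) :
      Ranking V (.termination rank)

/-- `rank` is of order `k`: `k` is the least number such that all values of `rank` are sequences
of length at most `k`. -/
def HasOrder {V : VASS L n} (rank : V.State → List ℕ) (k : ℕ) : Prop :=
  IsLeast {k' | ∀ σ, (rank σ).length ≤ k'} k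

end VASS

/-! By Farkas' lemma exactly one of `(A_t)` and `(B_t)` is solvable. Summing solutions of `(A_t)`
over all `t` outside `T` gives a circulation with non-negative effect that uses precisely the
transitions outside `T`. Read as a multiset of transitions, it splits into one Eulerian closed walk
per component of the system without `T` (`exists_component_walks`). The effects of these walks are
non-negative in total, though not necessarily one by one.

The lower bound is an induction over the recursive calls (`Ranking.exists_long_walk`). Any closed
walk `C` through all transitions can be replaced, for each `N`, by a closed walk of length at least
`N ^ k`, with effect at least that of `C`, along which counters drop by only `O(N)`; here `k + 1` is
the length of some rank value. For the step, the Eulerian walk of each component is replaced by the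
walk that the induction hypothesis provides, repeated `N` times and spliced into `C`. Comparison
with `effect C` is what carries the induction: the replacements do not worsen the total effect of
the Eulerian walks, so the repetitions together lose nothing, and each of them drops at most
linearly. Each level of recursion thus gains a factor `N` in length at the price of a larger linear
constant. Repeating the outermost walk `N` times from a valuation of size `O(N)` gives the last
factor.

A longest trace exists because the returned rank proves termination, steps branch finitely, and only
finitely many states are `N`-bounded. -/

open scoped Matrix

/-! ### Linear inequalities: Farkas' lemma and its integer form -/

/-- Farkas' lemma for finitely many linear functionals over a linearly ordered field. -/
theorem farkas_of_forall_nonpos {K W ι : Type*} [Field K] [LinearOrder K] [IsStrictOrderedRing K]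
    [AddCommGroup W] [Module K W] (s : Finset ι) (a : ι → W →ₗ[K] K) (b : W →ₗ[K] K)
    (h : ∀ y, (∀ i ∈ s, a i y ≤ 0) → b y ≤ 0) :
    ∃ x : ι → K, (∀ i, 0 ≤ x i) ∧ b = ∑ i ∈ s, x i • a i := by
  classical
  induction s using Finset.induction_on generalizing a b with
  | empty =>
    refine ⟨0, fun _ => le_rfl, ?_⟩
    ext y
    have h1 := h y (by simp)
    have h2 := h (-y) (by simp)
    simp only [map_neg] at h2
    simp only [Finset.sum_empty, LinearMap.zero_apply]
    linarith
  | insert j s hj ih =>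
    by_cases h0 : ∀ y, (∀ i ∈ s, a i y ≤ 0) → b y ≤ 0
    · obtain ⟨x, hx, hb⟩ := ih a b h0
      refine ⟨Function.update x j 0, fun i => ?_, ?_⟩
      · by_cases hi : i = j
        · subst hi; simp
        · simpa [hi] using hx i
      · rw [Finset.sum_insert hj, hb]
        simp only [Function.update_self, zero_smul, zero_add]
        refine Finset.sum_congr rfl fun i hi => ?_
        rw [Function.update_of_ne (ne_of_mem_of_not_mem hi hj)]
    · push Not at h0
      obtain ⟨y₀, hy₀, hby₀⟩ := h0
      have hpos : 0 < a j y₀ := by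
        by_contra hc
        push Not at hc
        exact absurd (h y₀ (by simpa [hc] using hy₀)) (not_le.2 hby₀)
      set v := (a j y₀)⁻¹ • y₀ with hv
      have hjv : a j v = 1 := by simp [hv, hpos.ne']
      have hsv : ∀ i ∈ s, a i v ≤ 0 := fun i hi => by
        simpa [hv] using mul_nonpos_of_nonneg_of_nonpos (inv_pos.2 hpos).le (hy₀ i hi)
      have hbv : 0 ≤ b v := by
        simpa [hv] using mul_nonneg (inv_pos.2 hpos).le hby₀.le
      -- The map `y ↦ y - a j y • v` projects onto the kernel of `a j`. The induction hypothesis is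
      -- applied to the functionals composed with it.
      obtain ⟨x, hx, hb⟩ := ih (fun i => a i - a i v • a j) (b - b v • a j) fun y hy => by
        have key := h (y - a j y • v) (by
          intro i hi
          rcases Finset.mem_insert.1 hi with rfl | hi
          · simp [hjv]
          · have := hy i hi
            simp only [LinearMap.sub_apply, LinearMap.smul_apply, smul_eq_mul, map_sub,
              map_smul] at this ⊢
            linarith)
        simp only [LinearMap.sub_apply, LinearMap.smul_apply, smul_eq_mul, map_sub,
          map_smul] at key ⊢
        linarith
      -- The coefficient of `a j` is forced by evaluation at `v`; it is non-negative since `b v ≥ 0`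
      -- and every `a i v ≤ 0`.
      refine ⟨Function.update x j (b v - ∑ i ∈ s, x i * a i v), fun i => ?_, ?_⟩
      · by_cases hi : i = j
        · subst hi
          simp only [Function.update_self, sub_nonneg]
          exact (Finset.sum_nonpos fun k hk =>
            mul_nonpos_of_nonneg_of_nonpos (hx k) (hsv k hk)).trans hbv
        · simpa [hi] using hx i
      · rw [Finset.sum_insert hj, Function.update_self]
        have e : ∑ i ∈ s, Function.update x j (b v - ∑ i ∈ s, x i * a i v) i • a i
            = ∑ i ∈ s, x i • a i := Finset.sum_congr rfl fun i hi => by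
          rw [Function.update_of_ne (ne_of_mem_of_not_mem hi hj)]
        rw [e]
        ext y
        have := congrArg (fun f => f y) hb
        simp only [LinearMap.sub_apply, LinearMap.smul_apply, smul_eq_mul, LinearMap.sum_apply,
          LinearMap.add_apply, mul_sub, Finset.sum_sub_distrib] at this ⊢
        have e2 : ∑ i ∈ s, x i * (a i v * a j y) = (∑ i ∈ s, x i * a i v) * a j y := by
          rw [Finset.sum_mul]; exact Finset.sum_congr rfl fun i _ => by ring
        rw [e2] at this
        linarith

theorem exists_pos_nat_mul_eq_intCast {ι : Type*} [Fintype ι] (q : ι → ℚ) :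
    ∃ (c : ℕ) (v : ι → ℤ), 0 < c ∧ ∀ i, (v i : ℚ) = c * q i := by
  classical
  refine ⟨∏ i, (q i).den, fun i => (∏ j ∈ Finset.univ.erase i, (q j).den : ℕ) * (q i).num,
    Finset.prod_pos fun i _ => (q i).den_pos, fun i => ?_⟩
  rw [← Finset.prod_erase_mul _ _ (Finset.mem_univ i)]
  push_cast
  rw [mul_assoc, Rat.den_mul_eq_num]

/-- A theorem of the alternative for integer matrices. -/
theorem exists_circulation_or_exists_ranking {ι κ τ : Type*} [Fintype ι] [Fintype κ] [Fintype τ]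
    (D : Matrix ι τ ℤ) (F : Matrix κ τ ℤ) (t : τ) :
    (∃ μ : τ → ℤ, 0 ≤ D *ᵥ μ ∧ 0 ≤ μ ∧ F *ᵥ μ = 0 ∧ 1 ≤ μ t) ∨
    ∃ (r : ι → ℤ) (z : κ → ℤ), 0 ≤ r ∧ (∀ t', (Dᵀ *ᵥ r + Fᵀ *ᵥ z) t' ≤ 0) ∧
      (Dᵀ *ᵥ r + Fᵀ *ᵥ z) t < 0 := by
  classical
  let row : (τ → ℤ) → (τ → ℚ) →ₗ[ℚ] ℚ := fun c => ∑ s, (c s : ℚ) • LinearMap.proj s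
  have hrow : ∀ c y, row c y = ∑ s, (c s : ℚ) * y s := fun c y => by simp [row]
  -- The cone `y ≥ 0`, `D y ≥ 0`, `F y = 0`, the equation being split into two inequalities. The
  -- alternative is whether `y t` can be positive on it.
  let a : τ ⊕ ι ⊕ κ ⊕ κ → (τ → ℚ) →ₗ[ℚ] ℚ :=
    Sum.elim (fun s => - LinearMap.proj s) (Sum.elim (fun i => - row (D i))
      (Sum.elim (fun k => row (F k)) (fun k => - row (F k))))
  by_cases h : ∀ y, (∀ i ∈ Finset.univ, a i y ≤ 0) → (LinearMap.proj t : (τ → ℚ) →ₗ[ℚ] ℚ) y ≤ 0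
  · right
    obtain ⟨x, hx, hb⟩ := farkas_of_forall_nonpos Finset.univ a _ h
    obtain ⟨c, v, hc, hv⟩ := exists_pos_nat_mul_eq_intCast x
    have hc' : (0 : ℚ) < c := by exact_mod_cast hc
    -- The Farkas identity at the `s`-th unit vector, multiplied by the common denominator `c`.
    have key : ∀ s, (((Dᵀ *ᵥ fun i => v (.inr (.inl i))) + Fᵀ *ᵥ fun k =>
        v (.inr (.inr (.inr k))) - v (.inr (.inr (.inl k)))) s : ℚ)
        = - (c * (if s = t then 1 else 0)) - c * x (.inl s) := by
      intro s
      have := congrArg (fun f => f (Pi.single s 1)) hb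
      simp only [Fintype.sum_sum_type, a, Sum.elim_inl, Sum.elim_inr, LinearMap.sum_apply,
        LinearMap.add_apply, LinearMap.smul_apply, LinearMap.neg_apply, hrow, LinearMap.proj_apply,
        Pi.single_apply, smul_eq_mul, mul_ite, mul_one, mul_zero, Finset.sum_ite_eq',
        Finset.mem_univ, if_true, mul_neg, Finset.sum_neg_distrib, eq_comm (a := t)] at this
      simp only [Pi.add_apply, Matrix.mulVec, dotProduct, Matrix.transpose_apply]
      push_cast
      simp only [hv, mul_sub, Finset.sum_sub_distrib]
      have e1 : ∀ f g : ι → ℚ, ∑ i, f i * (c * g i) = c * ∑ i, g i * f i := fun f g => by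
        rw [Finset.mul_sum]; exact Finset.sum_congr rfl fun i _ => by ring
      have e2 : ∀ f g : κ → ℚ, ∑ i, f i * (c * g i) = c * ∑ i, g i * f i := fun f g => by
        rw [Finset.mul_sum]; exact Finset.sum_congr rfl fun i _ => by ring
      rw [e1 (fun i => (D i s : ℚ)), e2 (fun i => (F i s : ℚ)), e2 (fun i => (F i s : ℚ)), this]
      ring
    refine ⟨fun i => v (.inr (.inl i)),
      fun k => v (.inr (.inr (.inr k))) - v (.inr (.inr (.inl k))), fun i => ?_, fun s => ?_, ?_⟩
    · have : (0 : ℚ) ≤ v (.inr (.inl i)) := by rw [hv]; exact mul_nonneg hc'.le (hx _)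
      exact_mod_cast this
    · have h1 := key s
      have h2 := mul_nonneg hc'.le (hx (.inl s))
      have h3 : (0 : ℚ) ≤ c * (if s = t then 1 else 0) := by split_ifs <;> simp
      have : (((Dᵀ *ᵥ fun i => v (.inr (.inl i))) + Fᵀ *ᵥ fun k =>
        v (.inr (.inr (.inr k))) - v (.inr (.inr (.inl k)))) s : ℚ) ≤ 0 := by linarith
      exact_mod_cast this
    · have h1 := key t
      have h2 := mul_nonneg hc'.le (hx (.inl t))
      rw [if_pos rfl] at h1
      have : (((Dᵀ *ᵥ fun i => v (.inr (.inl i))) + Fᵀ *ᵥ fun k =>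
        v (.inr (.inr (.inr k))) - v (.inr (.inr (.inl k)))) t : ℚ) < 0 := by linarith
      exact_mod_cast this
  · left
    push Not at h
    obtain ⟨y, hy, hyt⟩ := h
    obtain ⟨c, v, hc, hv⟩ := exists_pos_nat_mul_eq_intCast y
    have hc' : (0 : ℚ) < c := by exact_mod_cast hc
    have hmul : ∀ A : τ → ℤ, ((∑ s, A s * v s : ℤ) : ℚ) = c * row A y := fun A => by
      rw [hrow, Finset.mul_sum]
      push_cast
      exact Finset.sum_congr rfl fun s _ => by rw [hv]; ring
    refine ⟨v, fun i => ?_, fun s => ?_, funext fun k => ?_, ?_⟩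
    · have h1 := hy (.inr (.inl i)) (Finset.mem_univ _)
      simp only [a, Sum.elim_inr, Sum.elim_inl, LinearMap.neg_apply, neg_nonpos] at h1
      have h2 : (0 : ℚ) ≤ (∑ s, D i s * v s : ℤ) := by
        rw [hmul]; exact mul_nonneg hc'.le h1
      exact_mod_cast h2
    · have h1 := hy (.inl s) (Finset.mem_univ _)
      simp only [a, Sum.elim_inl, LinearMap.neg_apply, neg_nonpos, LinearMap.proj_apply] at h1
      have h2 : (0 : ℚ) ≤ v s := by rw [hv]; exact mul_nonneg hc'.le h1
      exact_mod_cast h2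
    · have h1 := hy (.inr (.inr (.inl k))) (Finset.mem_univ _)
      have h2 := hy (.inr (.inr (.inr k))) (Finset.mem_univ _)
      simp only [a, Sum.elim_inr, Sum.elim_inl, LinearMap.neg_apply, neg_nonpos] at h1 h2
      have h3 : ((∑ s, F k s * v s : ℤ) : ℚ) = 0 := by
        rw [hmul, le_antisymm h1 h2, mul_zero]
      exact_mod_cast h3
    · have h2 : (0 : ℚ) < v t := by rw [hv]; exact mul_pos hc' hyt
      have : 0 < v t := by exact_mod_cast h2
      omega

/-! ### Walks, balanced multisets and Eulerian closed walks -/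

namespace VASS

variable {L : Type*} {n : ℕ}

/-- `V.IsWalk x w y`: the list `w` of transitions of `V` is a walk from `x` to `y`. -/
def IsWalk (V : VASS L n) : L → List (VASSTransition L n) → L → Prop
  | x, [], y => x = y
  | x, t :: w, y => t ∈ V.trans ∧ t.1 = x ∧ V.IsWalk t.2.2 w y

/-- The sum of the updates along a list of transitions. -/
def effect (w : List (VASSTransition L n)) : Fin n → ℤ := (w.map fun t => t.2.1).sum

/-- Along `w` no counter ever drops by more than `B`. -/
def DropLE (w : List (VASSTransition L n)) (B : ℕ) : Prop :=
  ∀ p, p <+: w → ∀ i, -(B : ℤ) ≤ effect p i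

@[simp] theorem effect_nil : effect ([] : List (VASSTransition L n)) = 0 := rfl

@[simp] theorem effect_cons (t : VASSTransition L n) (w) : effect (t :: w) = t.2.1 + effect w := by
  simp [effect]

@[simp] theorem effect_append (u w : List (VASSTransition L n)) :
    effect (u ++ w) = effect u + effect w := by
  simp [effect]

variable {V S : VASS L n}

theorem IsWalk.mono (h : S.trans ⊆ V.trans) {w : List (VASSTransition L n)} :
    ∀ {x y}, S.IsWalk x w y → V.IsWalk x w y := by
  induction w with
  | nil => exact fun h => h
  | cons t w ih => exact fun hw => ⟨h hw.1, hw.2.1, ih hw.2.2⟩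

theorem isWalk_append {u w : List (VASSTransition L n)} : ∀ {x z},
    V.IsWalk x (u ++ w) z ↔ ∃ y, V.IsWalk x u y ∧ V.IsWalk y w z := by
  induction u with
  | nil => intro x z; simp [IsWalk]
  | cons t u ih =>
    intro x z
    simp only [List.cons_append, IsWalk, ih]
    constructor
    · rintro ⟨h1, h2, y, h3, h4⟩; exact ⟨y, ⟨h1, h2, h3⟩, h4⟩
    · rintro ⟨y, ⟨h1, h2, h3⟩, h4⟩; exact ⟨h1, h2, y, h3, h4⟩

theorem IsWalk.hasPath {w : List (VASSTransition L n)} : ∀ {x y}, V.IsWalk x w y →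
    V.HasPath x y := by
  induction w with
  | nil => rintro x y rfl; exact .refl
  | cons t w ih =>
    rintro x y ⟨h1, rfl, h3⟩
    exact .head ⟨t.2.1, h1⟩ (ih h3)

theorem HasPath.exists_isWalk {x y : L} (h : V.HasPath x y) : ∃ w, V.IsWalk x w y := by
  induction h using Relation.ReflTransGen.head_induction_on with
  | refl => exact ⟨[], rfl⟩
  | head h _ ih =>
    obtain ⟨d, hd⟩ := h
    obtain ⟨w, hw⟩ := ih
    exact ⟨_ :: w, hd, rfl, hw⟩

theorem HasPath.mono (h : S.trans ⊆ V.trans) {x y : L} (hp : S.HasPath x y) : V.HasPath x y :=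
  Relation.ReflTransGen.mono (fun _ _ hd => hd.imp fun _ hd => h hd) _ _ hp

theorem IsWalk.map_src {w : List (VASSTransition L n)} : ∀ {x y}, V.IsWalk x w y →
    (w : Multiset (VASSTransition L n)).map (fun t => t.1) + {y} =
      (w : Multiset (VASSTransition L n)).map (fun t => t.2.2) + {x} := by
  induction w with
  | nil => rintro x y rfl; rfl
  | cons t w ih =>
    rintro x y ⟨_, rfl, h3⟩
    have := ih h3
    simp only [← Multiset.cons_coe, Multiset.map_cons] at this ⊢
    rw [Multiset.cons_add, this, ← Multiset.singleton_add, ← Multiset.singleton_add]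
    abel

/-- A finite multiset of transitions with one more exit from `x` and one more entry to `y` contains
a walk from `x` to `y`. -/
theorem exists_isWalk_of_map_src (M : Multiset (VASSTransition L n)) (hM : ∀ t ∈ M, t ∈ V.trans)
    (x y : L) (h : M.map (fun t => t.1) + {y} = M.map (fun t => t.2.2) + {x}) :
    ∃ w, V.IsWalk x w y ∧ (w : Multiset (VASSTransition L n)) ≤ M := by
  induction hc : M.card generalizing M x with
  | zero =>
    rw [Multiset.card_eq_zero] at hc
    subst hc
    exact ⟨[], by simpa [IsWalk] using h.symm, by simp⟩
  | succ m ih =>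
    by_cases hxy : x = y
    · exact ⟨[], hxy, Multiset.zero_le _⟩
    -- For `x ≠ y` the balance equation forces some transition of `M` to leave `x`; follow it and
    -- remove it from `M`.
    have hx : x ∈ M.map (fun t => t.1) + {y} := by rw [h]; simp
    have hx' : x ∈ M.map (fun t => t.1) := by simpa [hxy] using hx
    obtain ⟨t, ht, rfl⟩ := Multiset.mem_map.1 hx'
    obtain ⟨M', rfl⟩ := Multiset.exists_cons_of_mem ht
    obtain ⟨w, hw, hwM⟩ := ih M' (fun s hs => hM s (Multiset.mem_cons_of_mem hs)) t.2.2 (by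
      have h' : {t.1} + (M'.map (fun t => t.1) + {y}) =
          {t.1} + (M'.map (fun t => t.2.2) + {t.2.2}) := by
        rw [Multiset.map_cons, Multiset.map_cons, ← Multiset.singleton_add,
          ← Multiset.singleton_add] at h
        rw [← add_assoc, h]
        abel
      exact add_left_cancel h') (by simpa using hc)
    exact ⟨t :: w, ⟨hM t ht, rfl, hw⟩, by
      rw [← Multiset.cons_coe]; exact Multiset.cons_le_cons t hwM⟩

/-- A multiset of transitions is balanced if each location is entered as often as it is left. -/
def Balanced (M : Multiset (VASSTransition L n)) : Prop :=
  M.map (fun t => t.1) = M.map fun t => t.2.2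

theorem Balanced.exists_isWalk {M : Multiset (VASSTransition L n)} (hM : Balanced M)
    (hV : ∀ t ∈ M, t ∈ V.trans) {t : VASSTransition L n} (ht : t ∈ M) :
    ∃ w, V.IsWalk t.2.2 w t.1 ∧ ((t :: w : List _) : Multiset (VASSTransition L n)) ≤ M := by
  obtain ⟨M', rfl⟩ := Multiset.exists_cons_of_mem ht
  obtain ⟨w, hw, hwM⟩ := exists_isWalk_of_map_src M'
    (fun s hs => hV s (Multiset.mem_cons_of_mem hs)) t.2.2 t.1 (by
      unfold Balanced at hM
      rwa [Multiset.map_cons, Multiset.map_cons, ← Multiset.singleton_add,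
          ← Multiset.singleton_add, add_comm, add_comm {t.2.2}] at hM)
  exact ⟨w, hw, by rw [← Multiset.cons_coe]; exact Multiset.cons_le_cons t hwM⟩

theorem Balanced.sub {M M' : Multiset (VASSTransition L n)} (hM : Balanced M)
    (hM' : Balanced (M + M')) : Balanced M' := by
  unfold Balanced at *
  rw [Multiset.map_add, Multiset.map_add, hM] at hM'
  exact add_left_cancel hM'

theorem IsWalk.balanced {x : L} {w : List (VASSTransition L n)} (h : V.IsWalk x w x) :
    Balanced (w : Multiset (VASSTransition L n)) :=
  add_right_cancel h.map_src

theorem exists_src_of_mem_locs (hV : V.Connected) {x l : L} (hx : x ∈ V.locs) (hl : l ∈ V.locs)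
    (hne : x ≠ l) : ∃ t ∈ V.trans, t.1 = x := by
  obtain h | ⟨y, ⟨d, hd⟩, _⟩ := Relation.ReflTransGen.cases_head (hV x hx l hl)
  · exact absurd h hne
  · exact ⟨_, hd, rfl⟩

theorem IsWalk.exists_split {x y : L} {w : List (VASSTransition L n)} (h : V.IsWalk x w y)
    {t : VASSTransition L n} (ht : t ∈ w) :
    ∃ u v, w = u ++ v ∧ V.IsWalk x u t.1 ∧ V.IsWalk t.1 v y := by
  obtain ⟨u, v, rfl⟩ := List.append_of_mem ht
  obtain ⟨z, h1, h2⟩ := isWalk_append.1 h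
  have : t.1 = z := h2.2.1
  subst this
  exact ⟨u, t :: v, rfl, h1, h2⟩

/-- A closed walk at `l` that uses all transitions passes through all locations. -/
theorem exists_split_of_mem_locs (hV : V.Connected) {l x : L} (hl : l ∈ V.locs) (hx : x ∈ V.locs)
    {w : List (VASSTransition L n)} (h : V.IsWalk l w l) (hw : ∀ t ∈ V.trans, t ∈ w) :
    ∃ u v, w = u ++ v ∧ V.IsWalk l u x ∧ V.IsWalk x v l := by
  by_cases hxl : x = l
  · subst hxl; exact ⟨[], w, rfl, rfl, h⟩
  · obtain ⟨t, ht, rfl⟩ := exists_src_of_mem_locs hV hx hl hxl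
    exact h.exists_split (hw t ht)

/-- Euler's theorem: a balanced multiset of transitions in which every transition of a connected
VASS occurs is traversed by a closed walk. -/
theorem exists_eulerian (hV : V.Connected) {l : L} (hl : l ∈ V.locs)
    {M : Multiset (VASSTransition L n)} (hM : Balanced M) (hMV : ∀ t, t ∈ M ↔ t ∈ V.trans) :
    ∃ w, V.IsWalk l w l ∧ (w : Multiset (VASSTransition L n)) = M := by
  classical
  -- Take a closed walk inside `M` that leaves the fewest transitions unused; `R` below is the
  -- unused rest.
  have hex : ∃ m, ∃ w, V.IsWalk l w l ∧ (w : Multiset (VASSTransition L n)) ≤ M ∧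
      M.card - w.length = m := ⟨_, [], rfl, Multiset.zero_le _, rfl⟩
  obtain ⟨w, hw, hwM, hlen⟩ := Nat.find_spec hex
  obtain ⟨R, hR⟩ := Multiset.le_iff_exists_add.1 hwM
  have hRb : Balanced R := hw.balanced.sub (hR ▸ hM)
  have hRV : ∀ t ∈ R, t ∈ V.trans := fun t ht => (hMV t).1 (by rw [hR]; simp [ht])
  -- An unused transition that starts on the walk would lie on a closed detour inside the balanced
  -- `R`, and splicing it in would contradict minimality.
  have hext : ∀ u v x, w = u ++ v → V.IsWalk l u x → V.IsWalk x v l → ∀ t ∈ R, t.1 ≠ x := by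
    rintro u v x rfl hu hv t ht rfl
    obtain ⟨c, hc, hcR⟩ := hRb.exists_isWalk hRV ht
    have hle : ((u ++ (t :: c) ++ v : List _) : Multiset (VASSTransition L n)) ≤ M := by
      rw [hR, ← Multiset.coe_add, ← Multiset.coe_add, ← Multiset.coe_add, add_right_comm]
      exact Multiset.add_le_add_left hcR
    have h1 := Nat.find_min' hex ⟨u ++ (t :: c) ++ v, isWalk_append.2 ⟨t.1, isWalk_append.2
      ⟨t.1, hu, ⟨hRV t ht, rfl, hc⟩⟩, hv⟩, hle, rfl⟩
    have h2 := Multiset.card_le_card hle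
    rw [← hlen] at h1
    simp only [List.length_append, List.length_cons, Multiset.coe_card] at h1 h2
    omega
  have hreach : ∀ x, V.HasPath l x → ∃ u v, w = u ++ v ∧ V.IsWalk l u x ∧ V.IsWalk x v l := by
    intro x hx
    induction hx with
    | refl => exact ⟨[], w, rfl, rfl, hw⟩
    | tail _ hbc ih =>
      obtain ⟨u, v, huv, hu, hv⟩ := ih
      obtain ⟨d, hd⟩ := hbc
      have hdM := (hMV _).2 hd
      rw [hR] at hdM
      rcases Multiset.mem_add.1 hdM with h | h
      · obtain ⟨u, v, rfl⟩ := List.append_of_mem (Multiset.mem_coe.1 h)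
        obtain ⟨z, h1, h2⟩ := isWalk_append.1 hw
        exact ⟨u ++ [_], v, by simp, isWalk_append.2 ⟨z, h1, h2.1, h2.2.1, rfl⟩, h2.2.2⟩
      · exact absurd rfl (hext u v _ huv hu hv _ h)
  have hR0 : R = 0 := by
    refine Multiset.eq_zero_of_forall_notMem fun t ht => ?_
    obtain ⟨u, v, huv, hu, hv⟩ := hreach t.1 (hV l hl _ (V.src_mem t (hRV t ht)))
    exact hext u v _ huv hu hv t ht rfl
  exact ⟨w, hw, by rw [hR, hR0, add_zero]⟩

/-- In a connected VASS some closed walk uses all transitions. -/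
theorem exists_covering_walk (hV : V.Connected) {l : L} (hl : l ∈ V.locs) :
    ∃ w, V.IsWalk l w l ∧ ∀ t ∈ V.trans, t ∈ w := by
  classical
  suffices h : ∀ s : Finset (VASSTransition L n), s ⊆ V.trans →
      ∃ w, V.IsWalk l w l ∧ ∀ t ∈ s, t ∈ w from h _ subset_rfl
  intro s
  induction s using Finset.induction_on with
  | empty => exact fun _ => ⟨[], rfl, by simp⟩
  | insert t s _ ih =>
    intro hs
    obtain ⟨w, hw, hws⟩ := ih fun x hx => hs (Finset.mem_insert_of_mem hx)
    have ht := hs (Finset.mem_insert_self t s)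
    obtain ⟨u, hu⟩ := (hV l hl _ (V.src_mem t ht)).exists_isWalk
    obtain ⟨v, hv⟩ := (hV _ (V.tgt_mem t ht) l hl).exists_isWalk
    refine ⟨w ++ (u ++ t :: v), isWalk_append.2 ⟨l, hw, isWalk_append.2 ⟨t.1, hu, ht, rfl, hv⟩⟩,
      fun x hx => ?_⟩
    rcases Finset.mem_insert.1 hx with rfl | hx
    · simp
    · simp [hws x hx]

/-! ### Drops -/

theorem DropLE.mono {w : List (VASSTransition L n)} {B B' : ℕ} (h : DropLE w B) (hB : B ≤ B') :
    DropLE w B' := fun p hp i => by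
  have := h p hp i
  have : (B : ℤ) ≤ B' := by exact_mod_cast hB
  linarith

theorem exists_dropLE (w : List (VASSTransition L n)) : ∃ B, DropLE w B := by
  induction w with
  | nil => exact ⟨0, fun p hp i => by simp [List.prefix_nil.1 hp]⟩
  | cons t w ih =>
    obtain ⟨B, hB⟩ := ih
    refine ⟨B + ∑ i, (t.2.1 i).natAbs, fun p hp i => ?_⟩
    rcases List.prefix_cons_iff.1 hp with rfl | ⟨q, rfl, hq⟩
    · simp only [effect_nil, Pi.zero_apply]; omega
    · have h1 := hB q hq i
      have h2 : (t.2.1 i).natAbs ≤ ∑ i, (t.2.1 i).natAbs :=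
        Finset.single_le_sum (f := fun i => (t.2.1 i).natAbs) (fun _ _ => Nat.zero_le _)
          (Finset.mem_univ i)
      rw [effect_cons, Pi.add_apply]
      omega

theorem prefix_append_iff {α : Type*} {p u w : List α} :
    p <+: u ++ w ↔ p <+: u ∨ ∃ q, p = u ++ q ∧ q <+: w := by
  constructor
  · rintro ⟨r, hr⟩
    rcases List.append_eq_append_iff.1 hr with ⟨a, h1, _⟩ | ⟨a, h1, h2⟩
    · exact .inl ⟨a, h1.symm⟩
    · exact .inr ⟨a, h1, r, h2.symm⟩
  · rintro (h | ⟨q, rfl, h⟩)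
    · exact h.trans (List.prefix_append _ _)
    · exact (List.prefix_append_right_inj u).2 h

/-- A prefix that ends after `v` differs in effect from a prefix of `u ++ w` by `effect v`, which is
itself at least `-B`; so the bounds add. -/
theorem DropLE.insert {u v w : List (VASSTransition L n)} {A B : ℕ} (h : DropLE (u ++ w) A)
    (hv : DropLE v B) : DropLE (u ++ v ++ w) (A + B) := by
  intro p hp i
  push_cast
  have hv' := hv v List.prefix_rfl i
  rcases prefix_append_iff.1 hp with hp | ⟨q, rfl, hq⟩
  · rcases prefix_append_iff.1 hp with hp | ⟨q, rfl, hq⟩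
    · have := h p (hp.trans (List.prefix_append _ _)) i
      omega
    · have h1 := h u (List.prefix_append _ _) i
      have h2 := hv q hq i
      rw [effect_append, Pi.add_apply]
      omega
  · have h1 := h (u ++ q) ((List.prefix_append_right_inj u).2 hq) i
    simp only [effect_append, Pi.add_apply] at h1 ⊢
    omega

/-- The `N`-fold repetition of a list. -/
def iter (w : List (VASSTransition L n)) : ℕ → List (VASSTransition L n)
  | 0 => []
  | N + 1 => w ++ iter w N

theorem IsWalk.iter {x : L} {w : List (VASSTransition L n)} (h : V.IsWalk x w x) (N : ℕ) :
    V.IsWalk x (iter w N) x := by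
  induction N with
  | zero => rfl
  | succ N ih => exact isWalk_append.2 ⟨x, h, ih⟩

theorem length_iter (w : List (VASSTransition L n)) (N : ℕ) :
    (iter w N).length = N * w.length := by
  induction N with
  | zero => simp [iter]
  | succ N ih => simp [iter, ih]; ring

theorem effect_iter (w : List (VASSTransition L n)) (N : ℕ) :
    effect (iter w N) = N • effect w := by
  induction N with
  | zero => simp [iter]
  | succ N ih => rw [iter, effect_append, ih, succ_nsmul']

/-- Each completed round costs at most `e`, and the current one drops at most `A`. -/
theorem DropLE.iter {w : List (VASSTransition L n)} {A e : ℕ} (h : DropLE w A)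
    (he : ∀ i, -(e : ℤ) ≤ effect w i) (N : ℕ) : DropLE (iter w N) (A + N * e) := by
  induction N with
  | zero => exact fun p hp i => by rw [List.prefix_nil.1 hp]; simp
  | succ N ih =>
    intro p hp i
    rcases prefix_append_iff.1 hp with hp | ⟨q, rfl, hq⟩
    · have h1 := h p hp i
      push_cast
      have : (0 : ℤ) ≤ (N + 1) * e := by positivity
      linarith
    · have h1 := ih q hq i
      have h2 := he i
      rw [effect_append, Pi.add_apply]
      push_cast at h1 ⊢
      linarith

/-- Insert closed walks into a closed walk that uses all transitions. -/
theorem exists_insert_walks {ι : Type*} (hV : V.Connected) {l : L} (hl : l ∈ V.locs)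
    {C : List (VASSTransition L n)} (hC : V.IsWalk l C l) (hCV : ∀ t ∈ V.trans, t ∈ C)
    {A : ℕ} (hA : DropLE C A) (J : Finset ι) (x : ι → L) (u : ι → List (VASSTransition L n))
    (b : ι → ℕ) (hx : ∀ j ∈ J, x j ∈ V.locs) (hu : ∀ j ∈ J, V.IsWalk (x j) (u j) (x j))
    (hb : ∀ j ∈ J, DropLE (u j) (b j)) :
    ∃ w, V.IsWalk l w l ∧ (∀ t ∈ V.trans, t ∈ w) ∧ DropLE w (A + ∑ j ∈ J, b j) ∧
      effect w = effect C + ∑ j ∈ J, effect (u j) ∧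
      w.length = C.length + ∑ j ∈ J, (u j).length := by
  classical
  induction J using Finset.induction_on with
  | empty => exact ⟨C, hC, hCV, by simpa using hA, by simp, by simp⟩
  | insert j J hj ih =>
    obtain ⟨w, hw, hwV, hwd, hwe, hwl⟩ := ih (fun i hi => hx i (Finset.mem_insert_of_mem hi))
      (fun i hi => hu i (Finset.mem_insert_of_mem hi))
      (fun i hi => hb i (Finset.mem_insert_of_mem hi))
    -- `w` still uses all transitions, hence passes through `x j`, where `u j` is spliced in.
    obtain ⟨p, q, rfl, hp, hq⟩ :=
      exists_split_of_mem_locs hV hl (hx j (Finset.mem_insert_self j J)) hw hwV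
    refine ⟨p ++ u j ++ q, isWalk_append.2 ⟨_, isWalk_append.2 ⟨_, hp,
      hu j (Finset.mem_insert_self j J)⟩, hq⟩, fun t ht => ?_, ?_, ?_, ?_⟩
    · have := hwV t ht
      simp only [List.mem_append] at this ⊢
      tauto
    · rw [Finset.sum_insert hj, add_comm (b j), ← add_assoc]
      exact hwd.insert (hb j (Finset.mem_insert_self j J))
    · rw [Finset.sum_insert hj]
      simp only [effect_append] at hwe ⊢
      rw [add_right_comm, hwe]
      abel
    · rw [Finset.sum_insert hj]
      simp only [List.length_append] at hwl ⊢
      omega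

theorem IsWalk.trace {w : List (VASSTransition L n)} : ∀ {x : V.locs} {y : L} {ν : Fin n → ℕ},
    V.IsWalk x w y → (∀ p, p <+: w → ∀ i, 0 ≤ (ν i : ℤ) + effect p i) →
    ∃ τ : V.State, V.Trace (x, ν) w.length τ := by
  induction w with
  | nil => exact fun _ _ => ⟨_, .nil _⟩
  | cons t w ih =>
    rintro ⟨x, hx⟩ y ν ⟨h1, h2, h3⟩ hν
    dsimp only at h2
    subst h2
    have hd : ∀ i, (((ν i + t.2.1 i).toNat : ℕ) : ℤ) = ν i + t.2.1 i := fun i => by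
      have := hν [t] (by simp) i
      simp only [effect_cons, effect_nil, add_zero] at this
      omega
    obtain ⟨τ, hτ⟩ := ih (x := ⟨t.2.2, V.tgt_mem t h1⟩) (ν := fun i => (ν i + t.2.1 i).toNat) h3
      fun p hp i => by
        have := hν (t :: p) ((List.prefix_cons_inj t).2 hp) i
        rw [effect_cons, Pi.add_apply] at this
        rw [hd]
        linarith
    exact ⟨τ, .cons ⟨hd, h1⟩ hτ⟩

end VASS

namespace VASS

variable {L : Type*} {n : ℕ}

/-! ### Strongly connected components -/

open Classical in
/-- The strongly connected component of the location `l`. -/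
noncomputable def scc (U : VASS L n) (l : L) : VASS L n where
  locs := {x ∈ U.locs | U.HasPath l x ∧ U.HasPath x l}
  trans := {t ∈ U.trans | (U.HasPath l t.1 ∧ U.HasPath t.1 l) ∧
    U.HasPath l t.2.2 ∧ U.HasPath t.2.2 l}
  src_mem t ht := by
    simp only [Finset.mem_filter] at ht ⊢
    exact ⟨U.src_mem t ht.1, ht.2.1⟩
  tgt_mem t ht := by
    simp only [Finset.mem_filter] at ht ⊢
    exact ⟨U.tgt_mem t ht.1, ht.2.2⟩

theorem mem_locs_scc {U : VASS L n} {l x : L} :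
    x ∈ (U.scc l).locs ↔ x ∈ U.locs ∧ U.HasPath l x ∧ U.HasPath x l := by
  simp [scc]

theorem mem_trans_scc {U : VASS L n} {l : L} {t : VASSTransition L n} :
    t ∈ (U.scc l).trans ↔ t ∈ U.trans ∧ t.1 ∈ (U.scc l).locs ∧ t.2.2 ∈ (U.scc l).locs := by
  simp only [scc, Finset.mem_filter]
  constructor
  · rintro ⟨h, h1, h2⟩
    exact ⟨h, ⟨U.src_mem t h, h1⟩, U.tgt_mem t h, h2⟩
  · rintro ⟨h, h1, h2⟩
    exact ⟨h, h1.2, h2.2⟩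

theorem self_mem_locs_scc {U : VASS L n} {l : L} (hl : l ∈ U.locs) : l ∈ (U.scc l).locs :=
  mem_locs_scc.2 ⟨hl, .refl, .refl⟩

theorem scc_le (U : VASS L n) (l : L) : U.scc l ≤ U :=
  ⟨fun _ h => (mem_locs_scc.1 h).1, fun _ h => (mem_trans_scc.1 h).1⟩

/-- Every location on a path from `l` to `a`, or from `a` to `l`, is mutually reachable with `l`
once `a` is, so these paths stay inside the component. -/
theorem connected_scc (U : VASS L n) (l : L) : (U.scc l).Connected := by
  have h1 : ∀ a, U.HasPath l a → U.HasPath a l → (U.scc l).HasPath l a := by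
    intro a hla
    induction hla with
    | refl => exact fun _ => .refl
    | @tail b c hlb hbc ih =>
      intro hcl
      obtain ⟨d, hd⟩ := hbc
      have hbl : U.HasPath b l := .head ⟨d, hd⟩ hcl
      have hlc : U.HasPath l c := .tail hlb ⟨d, hd⟩
      exact .tail (ih hbl) ⟨d, mem_trans_scc.2 ⟨hd, mem_locs_scc.2 ⟨U.src_mem _ hd, hlb, hbl⟩,
        mem_locs_scc.2 ⟨U.tgt_mem _ hd, hlc, hcl⟩⟩⟩
  have h2 : ∀ a, U.HasPath a l → U.HasPath l a → (U.scc l).HasPath a l := by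
    intro a hal
    induction hal using Relation.ReflTransGen.head_induction_on with
    | refl => exact fun _ => .refl
    | @head b c hbc hcl ih =>
      intro hlb
      obtain ⟨d, hd⟩ := hbc
      have hbl : U.HasPath b l := .head ⟨d, hd⟩ hcl
      have hlc : U.HasPath l c := .tail hlb ⟨d, hd⟩
      exact .head ⟨d, mem_trans_scc.2 ⟨hd, mem_locs_scc.2 ⟨U.src_mem _ hd, hlb, hbl⟩,
        mem_locs_scc.2 ⟨U.tgt_mem _ hd, hlc, hcl⟩⟩⟩ (ih hlc)
  intro a ha b hb
  obtain ⟨_, ha1, ha2⟩ := mem_locs_scc.1 ha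
  obtain ⟨_, hb1, hb2⟩ := mem_locs_scc.1 hb
  exact (h2 a ha2 ha1).trans (h1 b hb1 hb2)

theorem le_scc {U S : VASS L n} (hS : S ≤ U) (hc : S.Connected) {l : L} (hl : l ∈ S.locs) :
    S ≤ U.scc l := by
  have h : S.locs ⊆ (U.scc l).locs := fun x hx =>
    mem_locs_scc.2 ⟨hS.1 hx, (hc l hl x hx).mono hS.2, (hc x hx l hl).mono hS.2⟩
  exact ⟨h, fun t ht => mem_trans_scc.2 ⟨hS.2 ht, h (S.src_mem t ht), h (S.tgt_mem t ht)⟩⟩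

theorem scc_mem_sccs {U : VASS L n} {l : L} (hl : l ∈ U.locs) : U.scc l ∈ U.sccs :=
  ⟨⟨U.scc_le l, U.connected_scc l⟩, fun _ hS hle =>
    le_scc hS.1 hS.2 (hle.1 (self_mem_locs_scc hl))⟩

theorem scc_eq_of_mem {U : VASS L n} {l x : L} (hl : l ∈ U.locs) (hx : x ∈ (U.scc l).locs) :
    U.scc x = U.scc l := by
  obtain ⟨hxU, h1, h2⟩ := mem_locs_scc.1 hx
  exact le_antisymm (le_scc (U.scc_le x) (U.connected_scc x) (mem_locs_scc.2 ⟨hl, h2, h1⟩))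
    (le_scc (U.scc_le l) (U.connected_scc l) hx)

theorem mem_trans_scc_of_hasPath {U : VASS L n} {t : VASSTransition L n} (ht : t ∈ U.trans)
    (h : U.HasPath t.2.2 t.1) : t ∈ (U.scc t.1).trans :=
  mem_trans_scc.2 ⟨ht, self_mem_locs_scc (U.src_mem t ht), mem_locs_scc.2 ⟨U.tgt_mem t ht,
    .single ⟨t.2.1, ht⟩, h⟩⟩

/-! ### The constraint systems -/

variable {V : VASS L n}

theorem transpose_incidenceMatrix_mulVec (z : V.locs → ℤ) (t : V.trans) :
    (V.incidenceMatrixᵀ *ᵥ z) t =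
      z ⟨t.1.2.2, V.tgt_mem t.1 t.2⟩ - z ⟨t.1.1, V.src_mem t.1 t.2⟩ := by
  classical
  have h : ∀ (y : V.locs), ∑ x : V.locs, (if x.1 = y.1 then (1 : ℤ) else 0) * z x = z y := by
    intro y
    rw [Finset.sum_eq_single y]
    · simp
    · intro x _ hxy
      rw [if_neg (fun e => hxy (Subtype.ext e)), zero_mul]
    · simp
  simp only [Matrix.mulVec, dotProduct, Matrix.transpose_apply, incidenceMatrix, Matrix.of_apply,
    sub_mul, Finset.sum_sub_distrib]
  rw [← h ⟨t.1.2.2, V.tgt_mem t.1 t.2⟩, ← h ⟨t.1.1, V.src_mem t.1 t.2⟩]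

theorem transpose_updateMatrix_mulVec (r : Fin n → ℤ) (t : V.trans) :
    (V.updateMatrixᵀ *ᵥ r) t = ∑ i, r i * t.1.2.1 i := by
  simp only [Matrix.mulVec, dotProduct, Matrix.transpose_apply, updateMatrix, Matrix.of_apply]
  exact Finset.sum_congr rfl fun i _ => mul_comm _ _

/-- Row `t'` of `Dᵀ r + Fᵀ z` is the change of the affine function along `t'`. Since its values are
non-negative, `toNat` loses nothing. -/
theorem SolvesB.affineRank_le {t : V.trans} {r : Fin n → ℤ} {z : V.locs → ℤ}
    (h : V.SolvesB t r z) {σ τ : V.State} {d : Fin n → ℤ} (hst : V.Step σ d τ) :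
    affineRank r z τ ≤ affineRank r z σ ∧
      (t = ⟨_, hst.2⟩ → affineRank r z τ < affineRank r z σ) := by
  obtain ⟨hr, hz, hle, hlt⟩ := h
  have key : (V.updateMatrixᵀ *ᵥ r + V.incidenceMatrixᵀ *ᵥ z) ⟨_, hst.2⟩ =
      (∑ i, r i * (τ.2 i : ℤ) + z τ.1) - (∑ i, r i * (σ.2 i : ℤ) + z σ.1) := by
    rw [Pi.add_apply, transpose_incidenceMatrix_mulVec, transpose_updateMatrix_mulVec]
    have : ∑ i, r i * (τ.2 i : ℤ) = ∑ i, r i * (σ.2 i : ℤ) + ∑ i, r i * d i := by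
      rw [← Finset.sum_add_distrib]
      exact Finset.sum_congr rfl fun i _ => by rw [hst.1 i, mul_add]
    rw [this]
    ring
  have hτ : 0 ≤ ∑ i, r i * (τ.2 i : ℤ) + z τ.1 := add_nonneg
    (Finset.sum_nonneg fun i _ => mul_nonneg (hr i) (Int.natCast_nonneg _)) (hz _)
  have h1 := hle ⟨_, hst.2⟩
  rw [key] at h1
  refine ⟨Int.toNat_le_toNat (by linarith), ?_⟩
  rintro rfl
  rw [key] at hlt
  exact (Int.toNat_lt_toNat (by linarith)).2 (by linarith)

/-- The alternative gives a `z` of arbitrary sign. Each column of `F` sums to zero, so adding the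
constant `∑ |z y|` makes `z` non-negative without changing `Fᵀ z`. -/
theorem exists_solvesA_or_exists_solvesB (t : V.trans) :
    (∃ μ, V.SolvesA t μ) ∨ ∃ r z, V.SolvesB t r z := by
  rcases exists_circulation_or_exists_ranking V.updateMatrix V.incidenceMatrix t with
    h | ⟨r, z, hr, hle, hlt⟩
  · exact .inl h
  · right
    have e : V.incidenceMatrixᵀ *ᵥ (fun x => z x + ∑ y, |z y|) = V.incidenceMatrixᵀ *ᵥ z := by
      ext s
      simp only [transpose_incidenceMatrix_mulVec]
      ring
    refine ⟨r, fun x => z x + ∑ y, |z y|, hr, fun x => ?_, ?_, ?_⟩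
    · have h1 : |z x| ≤ ∑ y, |z y| :=
        Finset.single_le_sum (f := fun y => |z y|) (fun _ _ => abs_nonneg _) (Finset.mem_univ x)
      have h2 := neg_abs_le (z x)
      simp only [Pi.zero_apply]
      linarith
    · rwa [e]
    · rwa [e]

/-- Complementary slackness: pairing `Dᵀ r + Fᵀ z` with `μ` gives `r ⬝ᵥ D μ ≥ 0`, yet all summands
are non-positive and the one at `t` is negative if `μ t > 0`. -/
theorem SolvesB.eq_zero_of_circulation {t : V.trans} {r : Fin n → ℤ} {z : V.locs → ℤ}
    (h : V.SolvesB t r z) {μ : V.trans → ℤ} (hD : 0 ≤ V.updateMatrix *ᵥ μ) (h0 : 0 ≤ μ)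
    (hF : V.incidenceMatrix *ᵥ μ = 0) : μ t = 0 := by
  obtain ⟨hr, hz, hle, hlt⟩ := h
  have h1 : (V.updateMatrixᵀ *ᵥ r + V.incidenceMatrixᵀ *ᵥ z) ⬝ᵥ μ = r ⬝ᵥ (V.updateMatrix *ᵥ μ) := by
    rw [add_dotProduct, Matrix.mulVec_transpose, Matrix.mulVec_transpose,
      ← Matrix.dotProduct_mulVec, ← Matrix.dotProduct_mulVec, hF, dotProduct_zero, add_zero]
  have h2 : 0 ≤ r ⬝ᵥ (V.updateMatrix *ᵥ μ) :=
    Finset.sum_nonneg fun i _ => mul_nonneg (hr i) (hD i)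
  rw [← h1] at h2
  by_contra hne
  have hpos : 0 < μ t := lt_of_le_of_ne (h0 t) (Ne.symm hne)
  have : (V.updateMatrixᵀ *ᵥ r + V.incidenceMatrixᵀ *ᵥ z) ⬝ᵥ μ < 0 :=
    Finset.sum_neg' (fun s _ => mul_nonpos_of_nonpos_of_nonneg (hle s) (h0 s))
      ⟨t, Finset.mem_univ _, mul_neg_of_neg_of_pos hlt hpos⟩
  linarith

/-- A circulation with non-negative effect whose support is the complement of `V.decreasing`. -/
theorem exists_circulation (V : VASS L n) : ∃ μ : V.trans → ℤ, 0 ≤ V.updateMatrix *ᵥ μ ∧ 0 ≤ μ ∧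
    V.incidenceMatrix *ᵥ μ = 0 ∧ ∀ t, 0 < μ t ↔ t ∉ V.decreasing := by
  classical
  have hA : ∀ t, ∃ μ : V.trans → ℤ, 0 ≤ V.updateMatrix *ᵥ μ ∧ 0 ≤ μ ∧
      V.incidenceMatrix *ᵥ μ = 0 ∧ (t ∉ V.decreasing → 1 ≤ μ t) := by
    intro t
    by_cases ht : t ∈ V.decreasing
    · exact ⟨0, by simp, le_rfl, by simp, fun h => absurd ht h⟩
    · rcases exists_solvesA_or_exists_solvesB t with ⟨μ, h1, h2, h3, h4⟩ | h
      · exact ⟨μ, h1, h2, h3, fun _ => h4⟩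
      · exact absurd (by simpa [decreasing] using h) ht
  choose μ hD h0 hF h1 using hA
  have hD' : 0 ≤ V.updateMatrix *ᵥ ∑ t, μ t := by
    rw [Matrix.mulVec_sum]; exact Finset.sum_nonneg fun t _ => hD t
  have h0' : 0 ≤ ∑ t, μ t := Finset.sum_nonneg fun t _ => h0 t
  have hF' : V.incidenceMatrix *ᵥ ∑ t, μ t = 0 := by
    rw [Matrix.mulVec_sum]; exact Finset.sum_eq_zero fun t _ => hF t
  refine ⟨∑ t, μ t, hD', h0', hF', fun t => ⟨fun hpos ht => ?_, fun ht => ?_⟩⟩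
  · simp only [decreasing, Finset.mem_filter] at ht
    obtain ⟨r, z, hB⟩ := ht.2
    exact hpos.ne' (hB.eq_zero_of_circulation hD' h0' hF')
  · rw [Finset.sum_apply]
    exact lt_of_lt_of_le (by linarith [h1 t ht])
      (Finset.single_le_sum (f := fun s => μ s t) (fun s _ => h0 s t) (Finset.mem_univ t))

theorem mem_removeTrans {T : Finset V.trans} {t : VASSTransition L n} :
    t ∈ (V.removeTrans T).trans ↔ ∃ h : t ∈ V.trans, (⟨t, h⟩ : V.trans) ∉ T := by
  classical
  simp only [removeTrans, Finset.mem_filter]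
  exact ⟨fun h => ⟨h.1, h.2 h.1⟩, fun ⟨h, h'⟩ => ⟨h, fun _ => h'⟩⟩

theorem map_sum_nsmul_singleton {α β ι : Type*} (s : Finset ι) (m : ι → ℕ) (a : ι → α)
    (f : α → β) :
    (∑ t ∈ s, m t • ({a t} : Multiset α)).map f = ∑ t ∈ s, m t • ({f (a t)} : Multiset β) := by
  rw [← Multiset.coe_mapAddMonoidHom, map_sum]
  simp only [map_nsmul, Multiset.coe_mapAddMonoidHom, Multiset.map_singleton]

/-- A multicycle with non-negative effect through all transitions outside `V.decreasing`. -/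
theorem exists_multicycle (V : VASS L n) : ∃ M : Multiset (VASSTransition L n), Balanced M ∧
    (∀ t, t ∈ M ↔ t ∈ (V.removeTrans V.decreasing).trans) ∧ 0 ≤ (M.map fun t => t.2.1).sum := by
  classical
  obtain ⟨μ, hD, h0, hF, hμ⟩ := exists_circulation V
  refine ⟨∑ t : V.trans, (μ t).toNat • {t.1}, ?_, fun t => ?_, fun i => ?_⟩
  · unfold Balanced
    rw [map_sum_nsmul_singleton, map_sum_nsmul_singleton]
    ext l
    simp only [Multiset.count_sum', Multiset.count_nsmul, Multiset.count_singleton]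
    by_cases hl : l ∈ V.locs
    · have := congrFun hF ⟨l, hl⟩
      simp only [Matrix.mulVec, dotProduct, incidenceMatrix, Matrix.of_apply, sub_mul,
        Finset.sum_sub_distrib, Pi.zero_apply, sub_eq_zero] at this
      zify
      have e : ∀ t, ((μ t).toNat : ℤ) = μ t := fun t => Int.toNat_of_nonneg (h0 t)
      simp only [e]
      simp only [mul_comm (μ _)]
      exact this.symm
    · rw [Finset.sum_eq_zero, Finset.sum_eq_zero]
      · intro t _
        rw [if_neg (fun e : l = _ => hl (e ▸ V.tgt_mem t.1 t.2)), mul_zero]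
      · intro t _
        rw [if_neg (fun e : l = _ => hl (e ▸ V.src_mem t.1 t.2)), mul_zero]
  · simp only [Multiset.mem_sum, Finset.mem_univ, true_and, Multiset.mem_nsmul,
      Multiset.mem_singleton, mem_removeTrans]
    constructor
    · rintro ⟨s, hs, rfl⟩
      exact ⟨s.2, (hμ s).1 (by omega)⟩
    · rintro ⟨h, ht⟩
      exact ⟨⟨t, h⟩, by have := (hμ _).2 ht; omega, rfl⟩
  · rw [map_sum_nsmul_singleton, ← Multiset.coe_sumAddMonoidHom, map_sum]
    have := hD i
    simp only [Matrix.mulVec, dotProduct, updateMatrix, Matrix.of_apply] at this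
    simp only [map_nsmul, Multiset.coe_sumAddMonoidHom, Multiset.sum_singleton, Finset.sum_apply,
      Pi.smul_apply]
    refine this.trans (Finset.sum_le_sum fun t _ => ?_)
    rw [nsmul_eq_mul, Int.toNat_of_nonneg (h0 t), mul_comm]

/-- A transition outside `T` lies on a cycle of the multicycle, so no such transition leads from one
component to another. -/
theorem mem_trans_scc_src {t : VASSTransition L n}
    (ht : t ∈ (V.removeTrans V.decreasing).trans) :
    t ∈ ((V.removeTrans V.decreasing).scc t.1).trans := by
  obtain ⟨M, hM, hMV, _⟩ := exists_multicycle V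
  obtain ⟨w, hw, _⟩ := hM.exists_isWalk (fun t => (hMV t).1) ((hMV t).2 ht)
  exact mem_trans_scc_of_hasPath ht hw.hasPath

/-! ### Termination -/

/-- `qrank` never increases and drops strictly on `T`, while all other transitions stay in one
component. Hence an outer induction on `qrank` and an inner one on accessibility in the component.
-/
theorem Ranking.acc {V : VASS L n} {out : V.Output} (h : V.Ranking out) :
    ∀ rank, out = .termination rank →
      ∀ σ : V.State, Acc (fun τ σ => ∃ d, V.Step σ d τ) σ := by
  induction h with
  | empty V hV =>
    refine fun _ _ σ => ⟨_, fun τ ⟨d, hd⟩ => ?_⟩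
    exact absurd hd.2 (by rw [hV]; exact Finset.notMem_empty _)
  | stuck => exact fun _ h => by cases h
  | abort => exact fun _ h => by cases h
  | combine V hV hT r z hB qrank hq rankS hS rank hrank ih =>
    rintro _ -
    have hstep : ∀ {σ τ : V.State} {d} (hst : V.Step σ d τ), qrank τ ≤ qrank σ ∧
        ((⟨_, hst.2⟩ : V.trans) ∈ V.decreasing → qrank τ < qrank σ) := by
      intro σ τ d hst
      rw [hq, hq]
      exact ⟨Finset.sum_le_sum fun t ht => ((hB t ht).affineRank_le hst).1, fun hmem =>
        Finset.sum_lt_sum (fun t ht => ((hB t ht).affineRank_le hst).1)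
          ⟨_, hmem, ((hB _ hmem).affineRank_le hst).2 rfl⟩⟩
    suffices H : ∀ m, ∀ σ : V.State, qrank σ = m → Acc (fun τ σ => ∃ d, V.Step σ d τ) σ from
      fun σ => H _ σ rfl
    intro m
    induction m using Nat.strong_induction_on with
    | _ m ihm =>
      intro σ hσ
      have hσU : σ.1.1 ∈ (V.removeTrans V.decreasing).locs := σ.1.2
      have hmem := scc_mem_sccs hσU
      have hlocs : ((V.removeTrans V.decreasing).scc σ.1.1).locs ⊆ V.locs := hmem.1.1.1
      -- The bound is `≤ m`, not `= m`, because steps inside the component may also lower `qrank`.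
      suffices H : ∀ ρ : ((V.removeTrans V.decreasing).scc σ.1.1).State,
          qrank (liftState hlocs ρ) ≤ m →
            Acc (fun τ σ => ∃ d, V.Step σ d τ) (liftState hlocs ρ) from
        H (⟨σ.1.1, self_mem_locs_scc hσU⟩, σ.2) hσ.le
      intro ρ
      induction ih _ hmem _ rfl ρ with
      | intro ρ _ ihρ =>
        refine fun hρ => ⟨_, fun τ ⟨d, hd⟩ => ?_⟩
        obtain ⟨hle, hlt⟩ := hstep hd
        by_cases hdec : (⟨_, hd.2⟩ : V.trans) ∈ V.decreasing
        · exact ihm _ ((hlt hdec).trans_le hρ) τ rfl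
        · have htU := mem_trans_scc_src (mem_removeTrans.2 ⟨hd.2, hdec⟩)
          have e := scc_eq_of_mem hσU ρ.1.2
          have htS : (ρ.1.1, d, τ.1.1) ∈ ((V.removeTrans V.decreasing).scc σ.1.1).trans :=
            (Finset.ext_iff.1 (congrArg VASS.trans e) _).1 htU
          exact ihρ (⟨τ.1.1, VASS.tgt_mem _ _ htS⟩, τ.2) ⟨d, hd.1, htS⟩ (hle.trans hρ)

/-- König's argument: a state has finitely many successors, so the bounds for them have a maximum.
-/
theorem exists_trace_bound_of_acc {σ : V.State}
    (h : Acc (fun τ σ => ∃ d, V.Step σ d τ) σ) : ∃ b, ∀ m τ, V.Trace σ m τ → m ≤ b := by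
  induction h with
  | intro σ _ ih =>
    choose! b hb using ih
    have hfin : {τ : V.State | ∃ d, V.Step σ d τ}.Finite := by
      refine (Set.finite_range fun t : V.trans => ((⟨t.1.2.2, V.tgt_mem t.1 t.2⟩,
        fun i => ((σ.2 i : ℤ) + t.1.2.1 i).toNat) : V.State)).subset ?_
      rintro ⟨l, ν⟩ ⟨d, hd⟩
      refine ⟨⟨_, hd.2⟩, Prod.ext rfl (funext fun i => ?_)⟩
      have := hd.1 i
      dsimp only at this ⊢
      omega
    obtain ⟨B, hB⟩ := (hfin.image b).bddAbove
    refine ⟨B + 1, fun m τ hm => ?_⟩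
    cases hm with
    | nil => omega
    | cons hst htr =>
      have h1 := hb _ ⟨_, hst⟩ _ _ htr
      have h2 := hB ⟨_, ⟨_, hst⟩, rfl⟩
      omega

theorem Ranking.bddAbove_traceLengths {rank : V.State → List ℕ}
    (h : V.Ranking (.termination rank)) (N : ℕ) : BddAbove (V.traceLengths N) := by
  choose b hb using fun σ => exists_trace_bound_of_acc (h.acc rank rfl σ)
  have hfin : {σ : V.State | Bounded N σ}.Finite :=
    ((Set.toFinite (Set.univ : Set V.locs)).prod
      (Set.finite_Icc (0 : Fin n → ℕ) fun _ => N)).subset fun σ hσ =>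
        ⟨Set.mem_univ _, fun _ => Nat.zero_le _, hσ⟩
  obtain ⟨B, hB⟩ := (hfin.image b).bddAbove
  exact ⟨B, fun m ⟨σ, τ, hσ, hm⟩ => (hb σ m τ hm).trans (hB ⟨σ, hσ, rfl⟩)⟩

end VASS

namespace VASS

variable {L : Type*} {n : ℕ} {V : VASS L n}

/-! ### Long walks -/

theorem effect_eq_sum_coe (w : List (VASSTransition L n)) :
    effect w = ((w : Multiset (VASSTransition L n)).map fun t => t.2.1).sum := by
  simp [effect]

/-- The components of `(Locs(V), Trns(V) \ T)` carry closed walks that use all transitions of their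
component and have non-negative total effect. -/
theorem exists_component_walks (V : VASS L n) (J : Finset (VASS L n))
    (hJ : ∀ S, S ∈ J ↔ ∃ l ∈ V.locs, (V.removeTrans V.decreasing).scc l = S) :
    ∃ (x : J → L) (C : J → List (VASSTransition L n)),
      (∀ S : J, x S ∈ S.1.locs ∧ S.1.IsWalk (x S) (C S) (x S) ∧ ∀ t ∈ S.1.trans, t ∈ C S) ∧
      0 ≤ ∑ S, effect (C S) := by
  classical
  obtain ⟨M, hM, hMV, hM0⟩ := exists_multicycle V
  have hmem : ∀ l ∈ V.locs, ∀ t ∈ M, t ∈ ((V.removeTrans V.decreasing).scc l).trans ↔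
      (V.removeTrans V.decreasing).scc t.1 = (V.removeTrans V.decreasing).scc l := by
    intro l hl t ht
    have ht' := mem_trans_scc_src ((hMV t).1 ht)
    refine ⟨fun h => scc_eq_of_mem hl (mem_trans_scc.1 h).2.1, fun h => h ▸ ht'⟩
  have hex : ∀ S : J, ∃ (x : L) (C : List (VASSTransition L n)), (x ∈ S.1.locs ∧
      S.1.IsWalk x C x ∧ ∀ t ∈ S.1.trans, t ∈ C) ∧
      (C : Multiset (VASSTransition L n)) = M.filter (· ∈ S.1.trans) := by
    rintro ⟨S, hS⟩
    obtain ⟨l, hl, rfl⟩ := (hJ S).1 hS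
    dsimp only
    set S := (V.removeTrans V.decreasing).scc l
    -- Transitions of `M` never cross between components, so one that starts or ends in `S` belongs
    -- to `S`; filtering by either endpoint therefore preserves balance.
    have hbal : Balanced (M.filter (· ∈ S.trans)) := by
      have h1 : M.filter (· ∈ S.trans) = M.filter ((· ∈ S.locs) ∘ fun t => t.1) :=
        Multiset.filter_congr fun t ht => by
          refine ⟨fun h => S.src_mem t h, fun h => ?_⟩
          exact (hmem l hl t ht).2 (scc_eq_of_mem hl h)
      have h2 : M.filter (· ∈ S.trans) = M.filter ((· ∈ S.locs) ∘ fun t => t.2.2) :=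
        Multiset.filter_congr fun t ht => by
          refine ⟨fun h => S.tgt_mem t h, fun h => ?_⟩
          have ht' := mem_trans_scc_src ((hMV t).1 ht)
          refine (hmem l hl t ht).2 ?_
          refine Eq.trans ?_ (scc_eq_of_mem hl h)
          exact (scc_eq_of_mem ((V.removeTrans V.decreasing).src_mem t ((hMV t).1 ht))
            (mem_trans_scc.1 ht').2.2).symm
      unfold Balanced at hM ⊢
      conv_lhs => rw [h1, ← Multiset.filter_map, hM, Multiset.filter_map, ← h2]
    have hl' : l ∈ S.locs := self_mem_locs_scc hl
    obtain ⟨C, hC, hCM⟩ := exists_eulerian (connected_scc _ l) hl' hbal fun t => by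
      rw [Multiset.mem_filter, hMV]
      exact ⟨fun h => h.2, fun h => ⟨(scc_le _ l).2 h, h⟩⟩
    refine ⟨l, C, ⟨hl', hC, fun t ht => ?_⟩, hCM⟩
    rw [← Multiset.mem_coe, hCM, Multiset.mem_filter, hMV]
    exact ⟨(scc_le _ l).2 ht, ht⟩
  choose x C hC hCM using hex
  refine ⟨x, C, hC, ?_⟩
  have hsum : ∑ S : J, M.filter (· ∈ S.1.trans) = M := by
    ext t
    rw [Multiset.count_sum']
    simp only [Multiset.count_filter]
    by_cases ht : t ∈ M
    · have hl : t.1 ∈ V.locs := V.src_mem t (mem_removeTrans.1 ((hMV t).1 ht)).1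
      rw [Finset.sum_eq_single (⟨_, (hJ _).2 ⟨t.1, hl, rfl⟩⟩ : J)]
      · rw [if_pos ((hmem _ hl t ht).2 rfl)]
      · rintro ⟨S, hS⟩ _ hne
        obtain ⟨l, hl, rfl⟩ := (hJ S).1 hS
        exact if_neg fun h => hne (Subtype.ext ((hmem l hl t ht).1 h).symm)
      · simp
    · simp [Multiset.count_eq_zero_of_notMem ht]
  have : ∑ S, effect (C S) = (M.map fun t => t.2.1).sum := by
    simp only [effect_eq_sum_coe, hCM]
    conv_rhs => rw [← hsum]
    rw [← Multiset.coe_mapAddMonoidHom, map_sum, ← Multiset.coe_sumAddMonoidHom, map_sum]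
  rw [this]
  exact hM0

/-- From a closed walk through all transitions, one obtains closed walks whose length is a
polynomial in `N` of degree one less than the length of the rank, while the counters drop only
linearly. -/
theorem Ranking.exists_long_walk {V : VASS L n} {out : V.Output} (h : V.Ranking out) :
    ∀ rank, out = .termination rank → V.Connected → ∀ l ∈ V.locs, ∀ C, V.IsWalk l C l →
      (∀ t ∈ V.trans, t ∈ C) → ∀ (σ : V.State) (k : ℕ), (rank σ).length = k + 1 →
      ∃ c : ℕ, ∀ N : ℕ, 1 ≤ N → ∃ w, V.IsWalk l w l ∧ N ^ k ≤ w.length ∧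
        effect C ≤ effect w ∧ DropLE w (c * N) := by
  classical
  induction h with
  | empty V hV =>
    intro rank h _ l _ C _ _ σ k hk
    cases h
    simp at hk
  | stuck => exact fun _ h => by cases h
  | abort => exact fun _ h => by cases h
  | combine V hV hT r z hB qrank hq rankS hS rank hrank ih =>
    rintro _ h hconn l hl C hC hCV σ k hk
    cases h
    obtain ⟨A, hA⟩ := exists_dropLE C
    have hCne : C ≠ [] := by
      obtain ⟨t, ht⟩ := Finset.nonempty_iff_ne_empty.2 hV
      exact List.ne_nil_of_mem (hCV t ht)
    -- For exponent `0`, `C` itself works: it is non-empty, so its length is at least `N ^ 0 = 1`.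
    obtain _ | k := k
    · exact ⟨A, fun N hN => ⟨C, hC, by
        simpa [Nat.one_le_iff_ne_zero] using hCne, le_rfl,
        hA.mono (Nat.le_mul_of_pos_right A hN)⟩⟩
    let U := V.removeTrans V.decreasing
    have hσU : σ.1.1 ∈ U.locs := σ.1.2
    have hmem := scc_mem_sccs hσU
    have hk' : (rankS _ hmem (⟨σ.1.1, self_mem_locs_scc hσU⟩, σ.2)).length = k + 1 := by
      have : rank σ = _ := hrank _ hmem (⟨σ.1.1, self_mem_locs_scc hσU⟩, σ.2)
      rw [this] at hk
      simpa using hk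
    let J := V.locs.image U.scc
    have hJ : ∀ S, S ∈ J ↔ ∃ l ∈ V.locs, U.scc l = S := fun S => Finset.mem_image
    obtain ⟨x, D, hD, hD0⟩ := exists_component_walks V J hJ
    have hJV : ∀ S : J, S.1 ≤ V := by
      rintro ⟨S, hS⟩
      obtain ⟨a, _, rfl⟩ := (hJ S).1 hS
      exact ⟨(U.scc_le a).1, (U.scc_le a).2.trans fun t ht => (mem_removeTrans.1 ht).1⟩
    -- Only the component of `σ` has to supply length. The others keep their Eulerian walks, which
    -- are needed to compensate its effect.
    have hwalk : ∀ S : J, ∃ c : ℕ, ∀ N : ℕ, 1 ≤ N → ∃ w, S.1.IsWalk (x S) w (x S) ∧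
        (S.1 = U.scc σ.1.1 → N ^ k ≤ w.length) ∧ effect (D S) ≤ effect w ∧
        DropLE w (c * N) := by
      rintro ⟨S, hSJ⟩
      obtain ⟨hx, hDS, hDt⟩ := hD ⟨S, hSJ⟩
      by_cases hSσ : S = U.scc σ.1.1
      · subst hSσ
        obtain ⟨c, hc⟩ := ih _ hmem _ rfl (U.connected_scc _) _ hx _ hDS hDt _ k hk'
        exact ⟨c, fun N hN => by
          obtain ⟨w, h1, h2, h3, h4⟩ := hc N hN
          exact ⟨w, h1, fun _ => h2, h3, h4⟩⟩
      · obtain ⟨B, hB⟩ := exists_dropLE (D ⟨S, hSJ⟩)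
        exact ⟨B, fun N hN => ⟨_, hDS, fun h => absurd h hSσ, le_rfl,
          hB.mono (Nat.le_mul_of_pos_right B hN)⟩⟩
    choose c hc using hwalk
    -- `B S` bounds the loss of `D S`, hence of the replacing `u S`, independently of `N`; so `N`
    -- repetitions of `u S` lose at most `N * B S`.
    choose B hB using fun S : J => exists_dropLE (D S)
    refine ⟨A + ∑ S, (c S + B S), fun N hN => ?_⟩
    choose u hu hlen heff hdrop using fun S => hc S N hN
    obtain ⟨w, hw, -, hwd, hwe, hwl⟩ := exists_insert_walks hconn hl hC hCV hA Finset.univ x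
      (fun S => iter (u S) N) (fun S => c S * N + N * B S) (fun S _ => (hJV S).1 (hD S).1)
      (fun S _ => ((hu S).mono (hJV S).2).iter N)
      (fun S _ => (hdrop S).iter
        (fun i => (hB S _ List.prefix_rfl i).trans (heff S i)) N)
    refine ⟨w, hw, ?_, ?_, hwd.mono ?_⟩
    · have h1 := hlen ⟨_, (hJ _).2 ⟨σ.1.1, σ.1.2, rfl⟩⟩ rfl
      have h2 := Finset.single_le_sum (f := fun S => (iter (u S) N).length)
        (fun _ _ => Nat.zero_le _) (Finset.mem_univ (⟨_, (hJ _).2 ⟨σ.1.1, σ.1.2, rfl⟩⟩ : J))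
      rw [hwl, pow_succ']
      rw [length_iter] at h2
      exact (Nat.mul_le_mul_left N h1).trans (h2.trans (Nat.le_add_left _ _))
    · rw [hwe]
      refine le_add_of_nonneg_right ?_
      simp only [effect_iter]
      rw [← Finset.smul_sum]
      exact nsmul_nonneg (hD0.trans (Finset.sum_le_sum fun S _ => heff S)) N
    · rw [add_mul, Finset.sum_mul]
      refine Nat.add_le_add (Nat.le_mul_of_pos_right A hN) (Finset.sum_le_sum fun S _ => ?_)
      rw [add_mul, mul_comm N]

/-! ### From long walks to the lower bound on the complexity -/

theorem Ranking.exists_pow_le_mem_traceLengths {rank : V.State → List ℕ}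
    (h : V.Ranking (.termination rank)) (hV : V.Connected) (σ : V.State) {k : ℕ}
    (hk : (rank σ).length = k + 1) :
    ∃ K : ℕ, 0 < K ∧ ∀ N : ℕ, 1 ≤ N → ∃ m ∈ V.traceLengths (K * N), N ^ (k + 1) ≤ m := by
  obtain ⟨C, hC, hCV⟩ := exists_covering_walk hV σ.1.2
  obtain ⟨e, he⟩ := exists_dropLE C
  obtain ⟨c, hc⟩ := h.exists_long_walk rank rfl hV _ σ.1.2 C hC hCV σ k hk
  -- One round drops at most `c * N`, and `N` rounds lose at most `N * e` in total; the summand `1`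
  -- only makes the constant positive.
  refine ⟨c + e + 1, by omega, fun N hN => ?_⟩
  obtain ⟨w, hw, hwl, hwe, hwd⟩ := hc N hN
  have hd := hwd.iter (fun i => (he C List.prefix_rfl i).trans (hwe i)) N
  obtain ⟨τ, hτ⟩ := (hw.iter N).trace (x := σ.1) (ν := fun _ => (c + e + 1) * N) fun p hp i => by
    have := hd p hp i
    push_cast at this ⊢
    have h2 : (0 : ℤ) ≤ N := Int.natCast_nonneg _
    linarith
  refine ⟨_, ⟨_, τ, fun _ => le_rfl, hτ⟩, ?_⟩
  rw [length_iter, pow_succ']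
  exact Nat.mul_le_mul_left N hwl

theorem HasOrder.exists_length_eq {rank : V.State → List ℕ} {k : ℕ} (h : HasOrder rank k)
    (hk : 1 ≤ k) : ∃ σ, (rank σ).length = k := by
  by_contra hne
  push Not at hne
  obtain ⟨hle, hmin⟩ : IsLeast {k' | ∀ σ, (rank σ).length ≤ k'} k := h
  have : k ≤ k - 1 := hmin fun σ => by
    have h1 := hle σ
    have h2 := hne σ
    omega
  omega

theorem traceLengths_mono (V : VASS L n) {N N' : ℕ} (h : N ≤ N') :
    V.traceLengths N ⊆ V.traceLengths N' :=
  fun _ ⟨σ, τ, hσ, hm⟩ => ⟨σ, τ, fun i => (hσ i).trans h, hm⟩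

end VASS

theorem mainTheorem5 {L : Type*} {n : ℕ} (V : VASS L n) (hV : V.Connected)
    (rank : V.State → List ℕ) (hrank : V.Ranking (VASS.Output.termination rank))
    (k : ℕ) (hk : 1 ≤ k) (hord : VASS.HasOrder rank k) :
    (∀ N : ℕ, IsGreatest (V.traceLengths N) (V.comp N)) ∧
      Asymptotics.IsBigO Filter.atTop (fun N : ℕ => (N : ℝ) ^ k)
        (fun N : ℕ => (V.comp N : ℝ)) := by
  obtain ⟨σ, hσ⟩ := hord.exists_length_eq hk
  have hbdd := hrank.bddAbove_traceLengths
  refine ⟨fun N => ⟨Nat.sSup_mem ⟨0, (σ.1, 0), (σ.1, 0), fun _ => Nat.zero_le _, .nil _⟩ (hbdd N),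
    fun m hm => le_csSup (hbdd N) hm⟩, ?_⟩
  obtain ⟨k, rfl⟩ : ∃ j, k = j + 1 := ⟨k - 1, by omega⟩
  obtain ⟨K, hK, hlong⟩ := hrank.exists_pow_le_mem_traceLengths hV σ hσ
  -- The long walks are used with parameter `N / K`; the floor costs a factor of at most `2`, as `N
  -- ≤ 2 * K * (N / K)` for `N ≥ K`.
  refine Asymptotics.IsBigO.of_bound ((2 * K : ℝ) ^ (k + 1)) ?_
  filter_upwards [Filter.eventually_ge_atTop K] with N hN
  have hq : 1 ≤ N / K := (Nat.one_le_div_iff hK).2 hN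
  obtain ⟨m, hm, hle⟩ := hlong (N / K) hq
  have hcomp : (N / K) ^ (k + 1) ≤ V.comp N :=
    hle.trans (le_csSup (hbdd N) (V.traceLengths_mono (Nat.mul_div_le N K) hm))
  have hN2 : N ≤ 2 * K * (N / K) := by
    have h1 := Nat.div_add_mod N K
    have h2 := Nat.mod_lt N hK
    nlinarith
  have : N ^ (k + 1) ≤ (2 * K) ^ (k + 1) * V.comp N :=
    calc N ^ (k + 1) ≤ (2 * K * (N / K)) ^ (k + 1) := Nat.pow_le_pow_left hN2 _
      _ = (2 * K) ^ (k + 1) * (N / K) ^ (k + 1) := mul_pow _ _ _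
      _ ≤ _ := Nat.mul_le_mul_left _ hcomp
  rw [Real.norm_of_nonneg (by positivity), Real.norm_of_nonneg (by positivity)]
  exact_mod_cast this
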